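/- Let $K$ be a field, let $R = K\langle x,y\rangle/(xy-1)$ be the Toeplitz–Jacobson algebra, and let $S = R(1-yx)$ (a simple left ideal of $R$). For a left $R$-module $M$ and a cardinal $\alpha$ write $M^{(\alpha)}$ for the direct sum of $\alpha$ copies of $M$. Every projective left $R$-module $P$ is isomorphic to $R^{(\alpha)}\oplus S^{(\beta)}$ for some cardinals $\alpha,\beta$. Moreover, $(\alpha,\beta)$ can be chosen in one of the following forms: (1) $\alpha$ finite, and $\beta=0$ or $\beta\ge\aleph_0$; (2) $\alpha$ infinite, and $\beta=0$ or $\beta>\alpha$; (3) $\alpha=0$ and $\beta$ finite. These pairs completely describe the isomorphism types of projective left $R$-modules: every module $R^{(\alpha)}\oplus S^{(\beta)}$ is projective, for each projective $P$ there is exactly one pair $(\alpha,\beta)$ of one of these forms with $P\cong R^{(\alpha)}\oplus S^{(\beta)}$, and distinct pairs of these forms give non-isomorphic modules. -/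

import Mathlib

universe u v

namespace ToeplitzJacobson

/-- The single defining relation `x * y = 1` on the free associative `K`-algebra on two
generators, where `x` is the generator indexed by `0` and `y` the one indexed by `1`. -/
inductive Rel (K : Type*) [Field K] : FreeAlgebra K (Fin 2) → FreeAlgebra K (Fin 2) → Prop
  | xy : Rel K (FreeAlgebra.ι K 0 * FreeAlgebra.ι K 1) 1

/-- The (algebraic) Toeplitz-Jacobson algebra `R = K⟨x, y⟩ / (x y - 1)`. -/
abbrev Alg (K : Type*) [Field K] : Type _ := RingQuot (Rel K)

/-- The generator `x` of the Toeplitz-Jacobson algebra. -/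
noncomputable def x (K : Type*) [Field K] : Alg K :=
  RingQuot.mkAlgHom K (Rel K) (FreeAlgebra.ι K 0)

/-- The generator `y` of the Toeplitz-Jacobson algebra. -/
noncomputable def y (K : Type*) [Field K] : Alg K :=
  RingQuot.mkAlgHom K (Rel K) (FreeAlgebra.ι K 1)

/-- The left ideal `S = R (1 - y x)`, regarded as a left `R`-module (the faithful simple one). -/
noncomputable abbrev S (K : Type*) [Field K] : Ideal (Alg K) :=
  Ideal.span {1 - y K * x K}

/-- The left `R`-module `R^(α) ⊕ S^(β)`: the direct sum of `α` copies of `R` and `β` copies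
of `S`, for cardinals `α` and `β`. -/
abbrev DirectSumRS (K : Type*) [Field K] (α β : Cardinal.{v}) : Type _ :=
  (Quotient.out α →₀ Alg K) × (Quotient.out β →₀ S K)

/-- The normalized pairs `(α, β)` of cardinals:
* `α` is finite, and `β = 0` or `β ≥ ℵ₀`; or
* `α` is infinite, and `β = 0` or `β > α`; or
* `α = 0` and `β` is finite. -/
def IsNormalized (α β : Cardinal.{v}) : Prop :=
  (α < Cardinal.aleph0 ∧ (β = 0 ∨ Cardinal.aleph0 ≤ β)) ∨
  (Cardinal.aleph0 ≤ α ∧ (β = 0 ∨ α < β)) ∨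
  (α = 0 ∧ β < Cardinal.aleph0)

end ToeplitzJacobson

/-!
A projective module `P` embeds in a free module over a well-ordered index set. Every element of
`R` is carried into `K[x]` by a power of `x`, so each left ideal is generated, up to powers of `x`,
by one polynomial `g(x)`, which is zero or right regular. Lifting such generators of the ideals of
leading coefficients of `P` gives a free `Q ≤ P` such that every element of `P / Q` is killed by a
power of `x`. A vector `m` with `x m = 0` equals `(1 - y x) m`, hence lies in the image of the
simple module `S` under `s ↦ s m`; it follows that `P / Q` is a direct sum of copies of `S`. This is
projective, so `P ≅ Q ⊕ P / Q`.

The isomorphism `r ↦ (r y, r (1 - y x))` from `R` to `R ⊕ S` lets `R^(α)` absorb copies of `S`. In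
the other direction, the augmentation `x, y ↦ 1` kills `S` and recovers `α`, the kernel of `x`
has dimension `α * ℵ₀ + β`, and finite generation separates `β = 0` from `β ≥ ℵ₀` when `α` is
finite.
-/

namespace ToeplitzJacobson

section Leading

variable {R J : Type*} [Ring R] [LinearOrder J]

theorem exists_mem_support_forall_le {M : Type*} [Zero M] {p : J →₀ M} (hp : p ≠ 0) :
    ∃ i ∈ p.support, ∀ j ∈ p.support, j ≤ i :=
  p.support.exists_max_image id (Finsupp.support_nonempty_iff.2 hp)

theorem induction_supported_Iic [WellFoundedLT J] {motive : (J →₀ R) → Prop} (zero : motive 0)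
    (step : ∀ i, ∀ p ∈ Finsupp.supported R R (Set.Iic i),
      (∀ q ∈ Finsupp.supported R R (Set.Iio i), motive q) → motive p) (p : J →₀ R) :
    motive p := by
  have on_Iic : ∀ i, ∀ q ∈ Finsupp.supported R R (Set.Iic i), motive q := by
    intro i
    induction i using WellFoundedLT.induction with
    | ind i ih =>
      refine fun p hp => step i p hp fun q hq => ?_
      rcases eq_or_ne q 0 with rfl | hq0
      · exact zero
      · obtain ⟨m, hm, hmax⟩ := exists_mem_support_forall_le hq0
        exact ih m (hq hm) q hmax
  rcases eq_or_ne p 0 with rfl | hp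
  · exact zero
  · obtain ⟨m, -, hmax⟩ := exists_mem_support_forall_le hp
    exact on_Iic m p hmax

theorem mem_supported_Iio {i : J} {p : J →₀ R} (hp : p ∈ Finsupp.supported R R (Set.Iic i))
    (hpi : p i = 0) : p ∈ Finsupp.supported R R (Set.Iio i) := fun _ hj =>
  lt_of_le_of_ne (hp hj) fun h => Finsupp.mem_support_iff.1 hj (h ▸ hpi)

theorem apply_eq_zero_of_lt {i j : J} {p : J →₀ R}
    (hp : p ∈ Finsupp.supported R R (Set.Iic i)) (hij : i < j) : p j = 0 :=
  Finsupp.notMem_support_iff.1 fun hj => (hp hj).not_gt hij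

theorem linearIndependent_of_triangular {s : Set J} {w : J → J →₀ R}
    (hw : ∀ i, w i ∈ Finsupp.supported R R (Set.Iic i)) (hreg : ∀ i ∈ s, IsRightRegular (w i i)) :
    LinearIndepOn R w s := by
  refine linearIndependent_iff.2 fun c hc => by_contra fun hne => ?_
  obtain ⟨m, hm, hmax⟩ := exists_mem_support_forall_le hne
  have hlead : Finsupp.linearCombination R (fun i : s => w i) c m = c m * w m m := by
    rw [Finsupp.linearCombination_apply, Finsupp.sum, Finsupp.finsetSum_apply,
      Finset.sum_eq_single_of_mem m hm fun j hj hjm => ?_, Finsupp.smul_apply, smul_eq_mul]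
    rw [Finsupp.smul_apply,
      apply_eq_zero_of_lt (hw j) ((hmax j hj).lt_of_ne hjm : j < m), smul_zero]
  rw [hc, Finsupp.zero_apply, ← zero_mul (w m m)] at hlead
  exact Finsupp.mem_support_iff.1 hm (hreg m m.2 hlead).symm

/-- The left ideal of `i`-th coefficients of the elements of `N` supported in `(-∞, i]`, that is,
the ideal of leading coefficients in degree `i`. -/
noncomputable def leadingIdeal (N : Submodule R (J →₀ R)) (i : J) : Ideal R :=
  (N ⊓ Finsupp.supported R R (Set.Iic i)).map (Finsupp.lapply i)

theorem exists_pow_smul_mem_span [WellFoundedLT J] {t : R} {N : Submodule R (J →₀ R)}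
    {w : J → J →₀ R} (hw : ∀ i, w i ∈ N ⊓ Finsupp.supported R R (Set.Iic i))
    (hlead : ∀ i, ∀ r ∈ leadingIdeal N i, ∃ n, t ^ n * r ∈ Ideal.span {w i i})
    {p : J →₀ R} (hp : p ∈ N) :
    ∃ n, t ^ n • p ∈ Submodule.span R (w '' {i | w i i ≠ 0}) := by
  induction p using induction_supported_Iic with
  | zero => exact ⟨0, by rw [smul_zero]; exact zero_mem _⟩
  | step i p hpi ih =>
    obtain ⟨n, hn⟩ := hlead i (p i) ⟨p, ⟨hp, hpi⟩, rfl⟩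
    obtain ⟨a, ha⟩ := Ideal.mem_span_singleton'.1 hn
    obtain ⟨b, hb, hbw⟩ : ∃ b, b * w i i = a * w i i ∧
        b • w i ∈ Submodule.span R (w '' {i | w i i ≠ 0}) := by
      by_cases hi : w i i = 0
      · exact ⟨0, by simp only [hi, mul_zero], by rw [zero_smul]; exact zero_mem _⟩
      · exact ⟨a, rfl, Submodule.smul_mem _ a (Submodule.subset_span ⟨i, hi, rfl⟩)⟩
    have hlower : t ^ n • p - b • w i ∈ Finsupp.supported R R (Set.Iio i) :=
      mem_supported_Iio (sub_mem (Submodule.smul_mem _ _ hpi) (Submodule.smul_mem _ _ (hw i).2))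
        (by simp only [Finsupp.sub_apply, Finsupp.smul_apply, smul_eq_mul, hb, ha, sub_self])
    obtain ⟨m, hm⟩ := ih _ hlower (sub_mem (N.smul_mem _ hp) (N.smul_mem _ (hw i).1))
    refine ⟨m + n, ?_⟩
    rw [pow_add, mul_smul, ← sub_add_cancel (t ^ n • p) (b • w i), smul_add]
    exact add_mem hm (Submodule.smul_mem _ _ hbw)

end Leading

theorem exists_free_isTorsion'_quotient {R J P : Type*} [Ring R] [AddCommGroup P] [Module R P]
    {t : R} (hR : ∀ I : Ideal R, ∃ g ∈ I, (g = 0 ∨ IsRightRegular g) ∧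
      ∀ r ∈ I, ∃ n, t ^ n * r ∈ Ideal.span {g})
    {f : P →ₗ[R] J →₀ R} (hf : Function.Injective f) :
    ∃ Q : Submodule R P, Module.Free R Q ∧ Module.IsTorsion' (P ⧸ Q) (Submonoid.powers t) := by
  obtain ⟨_, _⟩ := exists_wellFoundedLT J
  choose g hg hreg hgen using fun i => hR (leadingIdeal (LinearMap.range f) i)
  choose w hw hwg using hg
  change ∀ i, w i i = g i at hwg
  simp only [← hwg] at hreg hgen
  choose b hb using fun i => (hw i).1
  have hli : LinearIndepOn R b {i | w i i ≠ 0} := by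
    refine LinearIndependent.of_comp f ?_
    simp only [Function.comp_def, hb]
    exact linearIndependent_of_triangular (fun i => (hw i).2) fun i hi =>
      (hreg i).resolve_left hi
  refine ⟨Submodule.span R (b '' {i | w i i ≠ 0}), ?_, ?_⟩
  · rw [Set.image_eq_range]
    exact .of_basis (.span hli)
  rw [Submodule.isTorsion'_powers_iff]
  intro q
  obtain ⟨p, rfl⟩ := Submodule.mkQ_surjective _ q
  obtain ⟨n, hn⟩ := exists_pow_smul_mem_span hw hgen ⟨p, rfl⟩
  have himage : w '' {i | w i i ≠ 0} = f '' (b '' {i | w i i ≠ 0}) := by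
    rw [Set.image_image]
    exact Set.image_congr fun i _ => (hb i).symm
  rw [himage, ← map_smul, Submodule.apply_mem_span_image_iff_mem_span hf] at hn
  exact ⟨n, (Submodule.Quotient.mk_eq_zero _).2 hn⟩

theorem exists_pow_smul_ne_zero_and_smul_pow_smul_eq_zero {R M : Type*} [Monoid R] [Zero M]
    [MulAction R M] {t : R} {m : M} (hm : m ≠ 0) (htors : ∃ n : ℕ, t ^ n • m = 0) :
    ∃ n : ℕ, t ^ n • m ≠ 0 ∧ t • t ^ n • m = 0 := by
  simpa only [pow_succ', mul_smul] using Nat.exists_not_and_succ_of_not_zero_of_exists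
    (p := fun n => t ^ n • m = 0) (by simpa only [pow_zero, one_smul]) htors

theorem projective_finsupp {R ι M : Type*} [Semiring R] [AddCommMonoid M] [Module R M]
    [Module.Projective R M] : Module.Projective R (ι →₀ M) := by
  classical
  exact .of_equiv (finsuppLequivDFinsupp R).symm

theorem nonempty_equiv_prod_quotient {R P : Type*} [Ring R] [AddCommGroup P] [Module R P]
    (Q : Submodule R P) [Module.Projective R (P ⧸ Q)] : Nonempty (P ≃ₗ[R] Q × P ⧸ Q) := by
  obtain ⟨l, hl⟩ := Module.projective_lifting_property Q.mkQ LinearMap.id Q.mkQ_surjective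
  exact ⟨((LinearMap.exact_subtype_mkQ Q).splitSurjectiveEquiv Q.subtype_injective ⟨l, hl⟩).1⟩

theorem nonempty_finsupp_prod_equiv {R : Type*} [Semiring R] (ι M N : Type*) [AddCommMonoid M]
    [Module R M] [AddCommMonoid N] [Module R N] :
    Nonempty ((ι →₀ M × N) ≃ₗ[R] (ι →₀ M) × (ι →₀ N)) :=
  ⟨.ofLinearMap
    ((Finsupp.mapRange.linearMap (.fst R M N)).prod (Finsupp.mapRange.linearMap (.snd R M N)))
    ((Finsupp.mapRange.linearMap (.inl R M N)).coprod (Finsupp.mapRange.linearMap (.inr R M N)))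
    (by ext <;> simp) (by ext <;> simp)⟩

section Idempotent

variable {R : Type*} [Ring R] {p : R}

theorem mem_span_iff_of_isIdempotentElem (hp : IsIdempotentElem p) {s : R} :
    s ∈ Ideal.span {p} ↔ s * p = s := by
  refine ⟨fun hs => ?_, fun hs => Ideal.mem_span_singleton'.2 ⟨s, hs⟩⟩
  obtain ⟨r, rfl⟩ := Ideal.mem_span_singleton'.1 hs
  rw [mul_assoc, hp.eq]

variable (p) in
/-- Right multiplication by `p` as a homomorphism onto the left ideal `R p`; a retraction of `R`
onto `R p` when `p` is idempotent. -/
noncomputable def mulRightToSpan : R →ₗ[R] Ideal.span {p} :=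
  (LinearMap.toSpanSingleton R R p).codRestrict _ fun r =>
    Ideal.mul_mem_left _ r (Ideal.mem_span_singleton_self p)

theorem projective_span_of_isIdempotentElem (hp : IsIdempotentElem p) :
    Module.Projective R (Ideal.span {p}) :=
  .of_split (Ideal.span {p}).subtype (mulRightToSpan p)
    (LinearMap.ext fun s => Subtype.ext ((mem_span_iff_of_isIdempotentElem hp).1 s.2))

end Idempotent

section OneSidedInverse

variable {R : Type*} [Ring R] {a b : R}

theorem mul_one_sub_mul (hab : a * b = 1) : a * (1 - b * a) = 0 := by
  rw [mul_sub, ← mul_assoc, hab, mul_one, one_mul, sub_self]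

theorem one_sub_mul_mul (hab : a * b = 1) : (1 - b * a) * b = 0 := by
  rw [sub_mul, mul_assoc, hab, mul_one, one_mul, sub_self]

theorem isIdempotentElem_one_sub_mul (hab : a * b = 1) : IsIdempotentElem (1 - b * a) := by
  rw [IsIdempotentElem, sub_mul, one_mul, mul_assoc, mul_one_sub_mul hab, mul_zero, sub_zero]

theorem mem_span_one_sub_mul_iff (hab : a * b = 1) {s : R} :
    s ∈ Ideal.span {1 - b * a} ↔ s * (1 - b * a) = s :=
  mem_span_iff_of_isIdempotentElem (isIdempotentElem_one_sub_mul hab)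

theorem nonempty_equiv_prod_span (hab : a * b = 1) :
    Nonempty (R ≃ₗ[R] R × Ideal.span {1 - b * a}) := by
  let toProd := (LinearMap.toSpanSingleton R R b).prod (mulRightToSpan (1 - b * a))
  let ofProd := (LinearMap.toSpanSingleton R R a).coprod (Ideal.span {1 - b * a}).subtype
  refine ⟨.ofLinearMap toProd ofProd (LinearMap.ext fun ⟨r, s, hs⟩ => ?_)
    (LinearMap.ext fun r => ?_)⟩
  · rw [mem_span_one_sub_mul_iff hab] at hs
    have hsb : s * b = 0 := by rw [← hs, mul_assoc, one_sub_mul_mul hab, mul_zero]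
    refine Prod.ext ?_ (Subtype.ext ?_)
    · change (r * a + s) * b = r
      rw [add_mul, mul_assoc, hab, mul_one, hsb, add_zero]
    · change (r * a + s) * (1 - b * a) = s
      rw [add_mul, mul_assoc, mul_one_sub_mul hab, mul_zero, zero_add, hs]
  · change r * b * a + r * (1 - b * a) = r
    rw [mul_assoc, ← mul_add, add_sub_cancel, mul_one]

theorem nonempty_finsupp_equiv_prod_finsupp_span (hab : a * b = 1) (κ : Type*) :
    Nonempty ((κ →₀ R) ≃ₗ[R] (κ →₀ R) × (κ →₀ Ideal.span {1 - b * a})) := by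
  obtain ⟨φ⟩ := nonempty_equiv_prod_span hab
  obtain ⟨ψ⟩ := nonempty_finsupp_prod_equiv (R := R) κ R (Ideal.span {1 - b * a})
  exact ⟨(Finsupp.mapRange.linearEquiv φ).trans ψ⟩

section Torsion

variable {M : Type*} [AddCommGroup M] [Module R M]

theorem one_sub_mul_smul_of_smul_eq_zero {m : M} (hm : a • m = 0) : (1 - b * a) • m = m := by
  rw [sub_smul, mul_smul, hm, smul_zero, sub_zero, one_smul]

/-- The homomorphism `s ↦ s • m` on a left ideal. For `I = R (1 - b a)` and `a • m = 0` its range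
contains `m`, so the simple module `I` maps nontrivially to every module with `a`-torsion. -/
noncomputable def smulHom (I : Ideal R) (m : M) : I →ₗ[R] M :=
  (LinearMap.toSpanSingleton R M m).domRestrict I

theorem mem_range_smulHom {m : M} (hm : a • m = 0) :
    m ∈ LinearMap.range (smulHom (Ideal.span {1 - b * a}) m) :=
  ⟨⟨_, Ideal.mem_span_singleton_self _⟩, one_sub_mul_smul_of_smul_eq_zero hm⟩

theorem mem_iSup_range_smulHom (hab : a * b = 1) {m : M} {n : ℕ} (hm : a ^ n • m = 0) :
    m ∈ ⨆ v : {v : M // a • v = 0}, LinearMap.range (smulHom (Ideal.span {1 - b * a}) v.1) := by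
  induction n generalizing m with
  | zero =>
    rw [pow_zero, one_smul] at hm
    rw [hm]
    exact zero_mem _
  | succ n ih =>
    have hdecomp : (1 - b * a) • m + b • a • m = m := by
      rw [← mul_smul, ← add_smul, sub_add_cancel, one_smul]
    have hker : a • (1 - b * a) • m = 0 := by rw [← mul_smul, mul_one_sub_mul hab, zero_smul]
    rw [← hdecomp]
    refine add_mem (Submodule.mem_iSup_of_mem ⟨_, hker⟩ (mem_range_smulHom hker))
      (Submodule.smul_mem _ _ (ih ?_))
    rw [← mul_smul, ← pow_succ, hm]

variable [IsSimpleModule R (Ideal.span {1 - b * a})]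

theorem nonempty_equiv_span_of_isTorsion' [IsSimpleModule R M]
    (hM : Module.IsTorsion' M (Submonoid.powers a)) :
    Nonempty (M ≃ₗ[R] Ideal.span {1 - b * a}) := by
  have := IsSimpleModule.nontrivial R M
  obtain ⟨m, hm⟩ := exists_ne (0 : M)
  obtain ⟨n, hn, han⟩ := exists_pow_smul_ne_zero_and_smul_pow_smul_eq_zero hm
    ((Submodule.isTorsion'_powers_iff _).1 hM m)
  have hhom : smulHom (Ideal.span {1 - b * a}) (a ^ n • m) ≠ 0 := fun h => by
    have hmem := mem_range_smulHom (b := b) han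
    rw [h, LinearMap.range_zero, Submodule.mem_bot] at hmem
    exact hn hmem
  exact ⟨(LinearEquiv.ofBijective _ (LinearMap.bijective_of_ne_zero hhom)).symm⟩

theorem isSemisimpleModule_of_isTorsion' (hab : a * b = 1)
    (hM : Module.IsTorsion' M (Submonoid.powers a)) : IsSemisimpleModule R M := by
  refine isSemisimpleModule_of_isSemisimpleModule_submodule'
    (p := fun v : {v : M // a • v = 0} =>
      LinearMap.range (smulHom (Ideal.span {1 - b * a}) v.1))
    (fun v => .range _) (eq_top_iff.2 fun m _ => ?_)
  obtain ⟨n, hn⟩ := (Submodule.isTorsion'_powers_iff _).1 hM m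
  exact mem_iSup_range_smulHom hab hn

end Torsion

theorem exists_equiv_finsupp_span_of_isTorsion' [IsSimpleModule R (Ideal.span {1 - b * a})]
    (hab : a * b = 1) {M : Type v} [AddCommGroup M] [Module R M]
    (hM : Module.IsTorsion' M (Submonoid.powers a)) :
    ∃ κ : Type v, Nonempty (M ≃ₗ[R] κ →₀ Ideal.span {1 - b * a}) := by
  have := isSemisimpleModule_of_isTorsion' hab hM
  have hiso : IsIsotypicOfType R M (Ideal.span {1 - b * a}) := fun N _ =>
    nonempty_equiv_span_of_isTorsion' ((Submodule.isTorsion'_powers_iff a).2 fun m =>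
      ((Submodule.isTorsion'_powers_iff a).1 hM m).imp fun _ hm => Subtype.ext hm)
  exact hiso.linearEquiv_finsupp

theorem exists_equiv_finsupp_prod_finsupp_span [IsSimpleModule R (Ideal.span {1 - b * a})]
    (hab : a * b = 1) (hR : ∀ I : Ideal R, ∃ g ∈ I, (g = 0 ∨ IsRightRegular g) ∧
      ∀ r ∈ I, ∃ n, a ^ n * r ∈ Ideal.span {g})
    (P : Type v) [AddCommGroup P] [Module R P] [Module.Projective R P] :
    ∃ ι κ : Type v, Nonempty (P ≃ₗ[R] (ι →₀ R) × (κ →₀ Ideal.span {1 - b * a})) := by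
  obtain ⟨f, hf⟩ := Module.projective_def.1 ‹Module.Projective R P›
  obtain ⟨Q, _, hQ⟩ := exists_free_isTorsion'_quotient hR hf.injective
  obtain ⟨κ, ⟨φ⟩⟩ := exists_equiv_finsupp_span_of_isTorsion' hab hQ
  have := projective_span_of_isIdempotentElem (isIdempotentElem_one_sub_mul hab)
  have : Module.Projective R (κ →₀ Ideal.span {1 - b * a}) := projective_finsupp
  have : Module.Projective R (P ⧸ Q) := .of_equiv φ.symm
  obtain ⟨ψ⟩ := nonempty_equiv_prod_quotient Q
  exact ⟨Module.Free.ChooseBasisIndex R Q, κ,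
    ⟨ψ.trans ((Module.Free.chooseBasis R Q).repr.prodCongr φ)⟩⟩

end OneSidedInverse

open Polynomial

section Algebra

variable {K : Type*} [Field K]

theorem x_mul_y : x K * y K = 1 := by
  rw [x, y, ← map_mul, RingQuot.mkAlgHom_rel K Rel.xy, map_one]

theorem induction {p : Alg K → Prop} (algebraMap : ∀ k, p (algebraMap K (Alg K) k))
    (x : p (x K)) (y : p (y K)) (add : ∀ r s, p r → p s → p (r + s))
    (mul : ∀ r s, p r → p s → p (r * s)) (r : Alg K) : p r := by
  obtain ⟨a, rfl⟩ := RingQuot.mkAlgHom_surjective K (Rel K) r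
  induction a using FreeAlgebra.induction with
  | grade0 k => rw [AlgHom.commutes]; exact algebraMap k
  | grade1 i => fin_cases i; exacts [x, y]
  | mul a b ha hb => rw [map_mul]; exact mul _ _ ha hb
  | add a b ha hb => rw [map_add]; exact add _ _ ha hb

/-- The algebra homomorphism out of `Alg K` determined by the images of `x` and `y`. -/
noncomputable def lift {B : Type*} [Semiring B] [Algebra K B] (a b : B) (h : a * b = 1) :
    Alg K →ₐ[K] B :=
  RingQuot.liftAlgHom K ⟨FreeAlgebra.lift K ![a, b], by rintro _ _ ⟨⟩; simp [h]⟩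

theorem lift_x {B : Type*} [Semiring B] [Algebra K B] (a b : B) (h : a * b = 1) :
    lift a b h (x K) = a := by simp [lift, x]

theorem lift_y {B : Type*} [Semiring B] [Algebra K B] (a b : B) (h : a * b = 1) :
    lift a b h (y K) = b := by simp [lift, y]

variable (K) in
/-- The idempotent `1 - y x`, the generator of `S`. -/
noncomputable def e : Alg K := 1 - y K * x K

theorem x_mul_e : x K * e K = 0 := mul_one_sub_mul x_mul_y

theorem e_mul_y : e K * y K = 0 := one_sub_mul_mul x_mul_y

theorem e_mul_of_x_mul_eq_zero {r : Alg K} (hr : x K * r = 0) : e K * r = r := by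
  rw [e, sub_mul, one_mul, mul_assoc, hr, mul_zero, sub_zero]

theorem mem_S_iff {s : Alg K} : s ∈ S K ↔ s * e K = s := mem_span_one_sub_mul_iff x_mul_y

theorem e_mem_S : e K ∈ S K := Ideal.mem_span_singleton_self _

theorem exists_x_pow_mul_eq_aeval (r : Alg K) :
    ∃ n, ∃ g : K[X], x K ^ n * r = aeval (x K) g := by
  have x_pow_add_mul {r : Alg K} {n : ℕ} {g : K[X]} (h : x K ^ n * r = aeval (x K) g) (m : ℕ) :
      x K ^ (m + n) * r = aeval (x K) (X ^ m * g) := by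
    rw [pow_add, mul_assoc, h, map_mul, aeval_X_pow]
  induction r using induction with
  | algebraMap k => exact ⟨0, C k, by rw [pow_zero, one_mul, aeval_C]⟩
  | x => exact ⟨0, X, by rw [pow_zero, one_mul, aeval_X]⟩
  | y => exact ⟨1, 1, by rw [pow_one, x_mul_y, map_one]⟩
  | add r s hr hs =>
    obtain ⟨n, g, hg⟩ := hr
    obtain ⟨m, f, hf⟩ := hs
    refine ⟨m + n, X ^ m * g + X ^ n * f, ?_⟩
    rw [mul_add, x_pow_add_mul hg, add_comm m n, x_pow_add_mul hf, map_add]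
  | mul r s hr hs =>
    obtain ⟨n, g, hg⟩ := hr
    obtain ⟨m, f, hf⟩ := hs
    have hcomm : Commute (x K ^ m) (aeval (x K) g) :=
      aeval_X_pow (R := K) (x K) ▸ (Commute.all (X ^ m) g).map (aeval (x K))
    refine ⟨m + n, g * f, ?_⟩
    rw [pow_add, mul_assoc, ← mul_assoc _ r s, hg, ← mul_assoc, hcomm.eq, mul_assoc, hf, map_mul]

theorem exists_e_mul_aeval_mul_eq (g : K[X]) (r : Alg K) :
    ∃ h : K[X], e K * aeval (x K) g * r = e K * aeval (x K) h := by
  induction r using induction generalizing g with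
  | algebraMap k => exact ⟨g * C k, by rw [map_mul, aeval_C, mul_assoc]⟩
  | x => exact ⟨g * X, by rw [map_mul, aeval_X, mul_assoc]⟩
  | y =>
    have hg : aeval (x K) g = aeval (x K) g.divX * x K + algebraMap K _ (g.coeff 0) := by
      conv_lhs => rw [← g.divX_mul_X_add, map_add, map_mul, aeval_X, aeval_C]
    refine ⟨g.divX, ?_⟩
    rw [hg, mul_assoc, add_mul, mul_assoc, x_mul_y, mul_one, Algebra.commutes, mul_add,
      ← mul_assoc, e_mul_y, zero_mul, add_zero]
  | add r s hr hs =>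
    obtain ⟨h, hh⟩ := hr g
    obtain ⟨h', hh'⟩ := hs g
    exact ⟨h + h', by rw [mul_add, hh, hh', map_add, mul_add]⟩
  | mul r s hr hs =>
    obtain ⟨h, hh⟩ := hr g
    obtain ⟨h', hh'⟩ := hs h
    exact ⟨h', by rw [← mul_assoc, hh, hh']⟩

theorem exists_e_mul_aeval_eq_of_x_mul_eq_zero {r : Alg K} (hr : x K * r = 0) :
    ∃ g : K[X], e K * aeval (x K) g = r := by
  obtain ⟨g, hg⟩ := exists_e_mul_aeval_mul_eq 1 r
  rw [map_one, mul_one, e_mul_of_x_mul_eq_zero hr] at hg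
  exact ⟨g, hg.symm⟩

variable (K) in
/-- The representation of `Alg K` on `K[X]` in which `x` acts by `divX` and `y` by
multiplication by `X`; it is used to separate the elements `e * g(x)`. -/
noncomputable def rep : Alg K →ₐ[K] Module.End K K[X] :=
  lift
    { toFun := divX
      map_add' := fun _ _ => divX_add
      map_smul' := fun k p => by simp [smul_eq_C_mul, divX_C_mul] }
    (LinearMap.mulLeft K X)
    (LinearMap.ext fun p => Polynomial.ext fun n => by simp [coeff_divX])

theorem rep_x (p : K[X]) : rep K (x K) p = divX p := by rw [rep, lift_x]; rfl

theorem rep_y (p : K[X]) : rep K (y K) p = X * p := by rw [rep, lift_y]; rfl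

theorem rep_e (p : K[X]) : rep K (e K) p = C (p.coeff 0) := by
  rw [e, map_sub, map_one, map_mul, LinearMap.sub_apply, Module.End.mul_apply, rep_x, rep_y,
    Module.End.one_apply, sub_eq_iff_eq_add']
  exact (X_mul_divX_add p).symm

theorem coeff_zero_rep_x_pow (n : ℕ) (p : K[X]) : (rep K (x K ^ n) p).coeff 0 = p.coeff n := by
  induction n generalizing p with
  | zero => rw [pow_zero, map_one, Module.End.one_apply]
  | succ n ih => rw [pow_succ, map_mul, Module.End.mul_apply, ih, rep_x, coeff_divX]

theorem coeff_zero_rep_aeval (g : K[X]) (n : ℕ) :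
    (rep K (aeval (x K) g) (X ^ n)).coeff 0 = g.coeff n := by
  induction g using Polynomial.induction_on' with
  | add p q hp hq => rw [map_add, map_add, LinearMap.add_apply, coeff_add, hp, hq, coeff_add]
  | monomial i a =>
    rw [aeval_monomial, map_mul, AlgHom.commutes, Module.End.mul_apply,
      Module.algebraMap_end_apply, coeff_smul, coeff_zero_rep_x_pow, coeff_X_pow, coeff_monomial,
      smul_ite, smul_zero, smul_eq_mul, mul_one]

theorem eq_zero_of_e_mul_aeval_eq_zero {g : K[X]} (hg : e K * aeval (x K) g = 0) : g = 0 := by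
  ext n
  have hcoeff : (rep K (e K * aeval (x K) g) (X ^ n)).coeff 0 = g.coeff n := by
    rw [map_mul, Module.End.mul_apply, rep_e, coeff_C_zero, coeff_zero_rep_aeval]
  rw [← hcoeff, hg, map_zero, LinearMap.zero_apply, coeff_zero, coeff_zero]

theorem e_ne_zero : e K ≠ 0 := fun h =>
  one_ne_zero (eq_zero_of_e_mul_aeval_eq_zero (K := K) (g := 1) (by rw [h, zero_mul]))

theorem eq_zero_of_mul_aeval_eq_zero {g : K[X]} (hg : g ≠ 0) {r : Alg K}
    (hr : r * aeval (x K) g = 0) : r = 0 := by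
  have e_mul_aeval_mul {h : K[X]} (h0 : e K * aeval (x K) h * aeval (x K) g = 0) : h = 0 := by
    rw [mul_assoc, ← map_mul] at h0
    exact (mul_eq_zero.1 (eq_zero_of_e_mul_aeval_eq_zero h0)).resolve_right hg
  by_contra hr0
  have htors : ∃ n, x K ^ n • r = 0 := by
    obtain ⟨n, h, hh⟩ := exists_x_pow_mul_eq_aeval r
    have h0 : h = 0 := e_mul_aeval_mul (by rw [← hh, mul_assoc, mul_assoc, hr, mul_zero, mul_zero])
    exact ⟨n, by rw [smul_eq_mul, hh, h0, map_zero]⟩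
  obtain ⟨n, hn, hxn⟩ := exists_pow_smul_ne_zero_and_smul_pow_smul_eq_zero hr0 htors
  obtain ⟨h, hh⟩ := exists_e_mul_aeval_eq_of_x_mul_eq_zero hxn
  have h0 : h = 0 := e_mul_aeval_mul (by rw [hh, smul_eq_mul, mul_assoc, hr, mul_zero])
  exact hn (by rw [← hh, h0, map_zero, mul_zero])

theorem exists_isRightRegular_generator_up_to_x_pow (I : Ideal (Alg K)) :
    ∃ g ∈ I, (g = 0 ∨ IsRightRegular g) ∧ ∀ r ∈ I, ∃ n, x K ^ n * r ∈ Ideal.span {g} := by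
  let J : Ideal K[X] := I.comap (aeval (x K))
  obtain ⟨g, hg⟩ := IsPrincipalIdealRing.principal J
  have hgJ : g ∈ J := hg ▸ Submodule.mem_span_singleton_self g
  refine ⟨aeval (x K) g, hgJ, ?_, fun r hr => ?_⟩
  · rcases eq_or_ne g 0 with rfl | hg0
    · exact .inl (map_zero _)
    · exact .inr (isRightRegular_of_non_zero_divisor _ fun _ => eq_zero_of_mul_aeval_eq_zero hg0)
  · obtain ⟨n, f, hf⟩ := exists_x_pow_mul_eq_aeval r
    have hfJ : f ∈ J := Ideal.mem_comap.2 (hf ▸ I.mul_mem_left _ hr)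
    obtain ⟨a, rfl⟩ := Submodule.mem_span_singleton.1 (hg ▸ hfJ)
    refine ⟨n, ?_⟩
    rw [hf, smul_eq_mul, map_mul]
    exact Ideal.mul_mem_left _ _ (Ideal.mem_span_singleton_self _)

end Algebra

section Existence

variable {K : Type*} [Field K]

theorem aeval_mul_e (g : K[X]) : aeval (x K) g * e K = g.coeff 0 • e K := by
  conv_lhs => rw [← g.divX_mul_X_add]
  rw [map_add, map_mul, aeval_X, aeval_C, add_mul, mul_assoc, x_mul_e, mul_zero, zero_add,
    Algebra.smul_def]

theorem exists_smul_e_eq_of_x_mul_eq_zero {s : Alg K} (hs : s ∈ S K) (hxs : x K * s = 0) :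
    ∃ c : K, c • e K = s := by
  obtain ⟨g, hg⟩ := exists_e_mul_aeval_eq_of_x_mul_eq_zero hxs
  have he : e K * e K = e K := mem_S_iff.1 e_mem_S
  exact ⟨g.coeff 0, by rw [← mem_S_iff.1 hs, ← hg, mul_assoc, aeval_mul_e, mul_smul_comm, he]⟩

theorem exists_x_pow_mul_eq_zero_of_mem_S {s : Alg K} (hs : s ∈ S K) : ∃ n, x K ^ n * s = 0 := by
  obtain ⟨n, g, hg⟩ := exists_x_pow_mul_eq_aeval s
  refine ⟨n + 1, ?_⟩
  rw [← mem_S_iff.1 hs, pow_succ', mul_assoc, ← mul_assoc _ s, hg, aeval_mul_e,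
    mul_smul_comm, x_mul_e, smul_zero]

theorem exists_mul_eq_e_of_mem_S {s : Alg K} (hs : s ∈ S K) (hs0 : s ≠ 0) :
    ∃ r, r * s = e K := by
  obtain ⟨n, hn, hxn⟩ := exists_pow_smul_ne_zero_and_smul_pow_smul_eq_zero (t := x K) hs0
    (exists_x_pow_mul_eq_zero_of_mem_S hs)
  obtain ⟨c, hc⟩ := exists_smul_e_eq_of_x_mul_eq_zero ((S K).smul_mem _ hs) hxn
  have hc0 : c ≠ 0 := by
    rintro rfl
    exact hn (by rw [← hc, zero_smul])
  refine ⟨c⁻¹ • x K ^ n, ?_⟩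
  rw [smul_mul_assoc, ← smul_eq_mul (x K ^ n), ← hc, inv_smul_smul₀ hc0]

instance : Nontrivial (S K) :=
  ⟨⟨e K, e_mem_S⟩, 0, fun h => e_ne_zero (congrArg Subtype.val h)⟩

instance : IsSimpleModule (Alg K) (S K) := by
  refine isSimpleModule_iff_toSpanSingleton_surjective.2 ⟨inferInstance, fun s hs z => ?_⟩
  obtain ⟨r, hr⟩ := exists_mul_eq_e_of_mem_S s.2 fun h => hs (Subtype.ext h)
  refine ⟨z * r, Subtype.ext ?_⟩
  change z * r * s = (z : Alg K)
  rw [mul_assoc, hr, mem_S_iff.1 z.2]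

instance : Module.Projective (Alg K) (S K) :=
  projective_span_of_isIdempotentElem (isIdempotentElem_one_sub_mul x_mul_y)

theorem exists_equiv_finsupp_prod_finsupp_S (P : Type v) [AddCommGroup P] [Module (Alg K) P]
    [Module.Projective (Alg K) P] :
    ∃ ι κ : Type v, Nonempty (P ≃ₗ[Alg K] (ι →₀ Alg K) × (κ →₀ S K)) :=
  exists_equiv_finsupp_prod_finsupp_span x_mul_y exists_isRightRegular_generator_up_to_x_pow P

end Existence

open Cardinal

section Absorption

variable {K : Type*} [Field K]

theorem nonempty_directSumRS_mk_equiv (ι κ : Type v) :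
    Nonempty (DirectSumRS K #ι #κ ≃ₗ[Alg K] (ι →₀ Alg K) × (κ →₀ S K)) :=
  ⟨(Finsupp.domLCongr outMkEquiv).prodCongr (Finsupp.domLCongr outMkEquiv)⟩

theorem nonempty_directSumRS_add_add_equiv (κ α β : Cardinal.{v}) :
    Nonempty (DirectSumRS K (κ + α) (κ + β) ≃ₗ[Alg K] DirectSumRS K (κ + α) β) := by
  induction κ, α, β using Cardinal.inductionOn₃ with | _ κ ι κ' =>
  rw [add_def, add_def]
  obtain ⟨f⟩ := nonempty_directSumRS_mk_equiv (K := K) (κ ⊕ ι) (κ ⊕ κ')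
  obtain ⟨g⟩ := nonempty_directSumRS_mk_equiv (K := K) (κ ⊕ ι) κ'
  obtain ⟨absorb⟩ := nonempty_finsupp_equiv_prod_finsupp_span (R := Alg K) x_mul_y κ
  let splitR := Finsupp.sumFinsuppLEquivProdFinsupp (Alg K) (M := Alg K) (α := κ) (β := ι)
  let splitS := Finsupp.sumFinsuppLEquivProdFinsupp (Alg K) (M := S K) (α := κ) (β := κ')
  exact ⟨f ≪≫ₗ splitR.prodCongr splitS ≪≫ₗ LinearEquiv.prodProdProdComm _ _ _ _ _ ≪≫ₗ
    absorb.symm.prodCongr (.refl _ _) ≪≫ₗ (LinearEquiv.prodAssoc _ _ _ _).symm ≪≫ₗ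
    splitR.symm.prodCongr (.refl _ _) ≪≫ₗ g.symm⟩

theorem nonempty_directSumRS_add_equiv {α β : Cardinal.{v}} (h : β ≤ α) (γ : Cardinal.{v}) :
    Nonempty (DirectSumRS K α (β + γ) ≃ₗ[Alg K] DirectSumRS K α γ) := by
  obtain ⟨δ, rfl⟩ := exists_add_of_le h
  exact nonempty_directSumRS_add_add_equiv β δ γ

theorem nonempty_directSumRS_equiv_zero_of_le {α β : Cardinal.{v}} (h : β ≤ α) :
    Nonempty (DirectSumRS K α β ≃ₗ[Alg K] DirectSumRS K α 0) :=
  add_zero β ▸ nonempty_directSumRS_add_equiv h 0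

theorem nonempty_directSumRS_equiv_zero_of_lt_aleph0 {α β : Cardinal.{v}} (hα : α ≠ 0)
    (hβ : β < ℵ₀) : Nonempty (DirectSumRS K α β ≃ₗ[Alg K] DirectSumRS K α 0) := by
  obtain ⟨n, rfl⟩ := lt_aleph0.1 hβ
  clear hβ
  induction n with
  | zero => exact ⟨Nat.cast_zero (R := Cardinal.{v}) ▸ .refl _ _⟩
  | succ n ih =>
    rw [Nat.cast_succ, add_comm]
    obtain ⟨f⟩ :=
      nonempty_directSumRS_add_equiv (K := K) (Cardinal.one_le_iff_ne_zero.2 hα) (n : Cardinal.{v})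
    exact ih.map f.trans

theorem isNormalized_zero_right (α : Cardinal.{v}) : IsNormalized α 0 :=
  (lt_or_ge α ℵ₀).imp (⟨·, .inl rfl⟩) fun h => .inl ⟨h, .inl rfl⟩

theorem isNormalized_zero_left (β : Cardinal.{v}) : IsNormalized 0 β :=
  (lt_or_ge β ℵ₀).elim (fun h => .inr (.inr ⟨rfl, h⟩))
    fun h => .inl ⟨aleph0_pos, .inr h⟩

theorem isNormalized_of_lt_of_aleph0_le {α β : Cardinal.{v}} (h : α < β) (hβ : ℵ₀ ≤ β) :
    IsNormalized α β :=
  (lt_or_ge α ℵ₀).imp (⟨·, .inr hβ⟩) fun hα => .inl ⟨hα, .inr h⟩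

theorem exists_isNormalized_equiv (α β : Cardinal.{v}) :
    ∃ γ, IsNormalized α γ ∧ Nonempty (DirectSumRS K α β ≃ₗ[Alg K] DirectSumRS K α γ) := by
  rcases eq_or_ne α 0 with rfl | hα
  · exact ⟨β, isNormalized_zero_left β, ⟨.refl _ _⟩⟩
  rcases le_or_gt β α with hβα | hαβ
  · exact ⟨0, isNormalized_zero_right α, nonempty_directSumRS_equiv_zero_of_le hβα⟩
  rcases lt_or_ge β ℵ₀ with hβ | hβ
  · exact ⟨0, isNormalized_zero_right α, nonempty_directSumRS_equiv_zero_of_lt_aleph0 hα hβ⟩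
  · exact ⟨β, isNormalized_of_lt_of_aleph0_le hαβ hβ, ⟨.refl _ _⟩⟩

theorem exists_isNormalized_equiv_directSumRS (P : Type v) [AddCommGroup P] [Module (Alg K) P]
    [Module.Projective (Alg K) P] :
    ∃ α β : Cardinal.{v}, IsNormalized α β ∧ Nonempty (P ≃ₗ[Alg K] DirectSumRS K α β) := by
  obtain ⟨ι, κ, ⟨f⟩⟩ := exists_equiv_finsupp_prod_finsupp_S (K := K) P
  obtain ⟨g⟩ := nonempty_directSumRS_mk_equiv (K := K) ι κ
  obtain ⟨β, hβ, ⟨h⟩⟩ := exists_isNormalized_equiv (K := K) #ι #κ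
  exact ⟨#ι, β, hβ, ⟨f ≪≫ₗ g.symm ≪≫ₗ h⟩⟩

theorem projective_directSumRS (α β : Cardinal.{v}) :
    Module.Projective (Alg K) (DirectSumRS K α β) := by
  have : Module.Projective (Alg K) (Quotient.out β →₀ S K) := projective_finsupp
  infer_instance

end Absorption

section Augmentation

variable {K : Type*} [Field K]

variable (K) in
/-- The augmentation `x, y ↦ 1`, which vanishes on `S` and so detects the rank of the free part of
`R^(ι) ⊕ S^(κ)`. -/
noncomputable def aug : Alg K →ₐ[K] K := lift 1 1 (one_mul 1)

theorem aug_eq_zero_of_mem_S {s : Alg K} (hs : s ∈ S K) : aug K s = 0 := by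
  have he : aug K (e K) = 0 := by
    rw [e, map_sub, map_mul, map_one, aug, lift_x, lift_y, mul_one, sub_self]
  rw [← mem_S_iff.1 hs, map_mul, he, mul_zero]

variable (K) in
/-- The coordinatewise augmentation of a free module. -/
noncomputable def augMap (ι : Type*) : (ι →₀ Alg K) →ₗ[K] (ι →₀ K) :=
  Finsupp.mapRange.linearMap (aug K).toLinearMap

theorem augMap_smul {ι : Type*} (r : Alg K) (p : ι →₀ Alg K) :
    augMap K ι (r • p) = aug K r • augMap K ι p :=
  Finsupp.ext fun i => map_mul (aug K) r (p i)

theorem augMap_surjective (ι : Type*) : Function.Surjective (augMap K ι) :=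
  Finsupp.mapRange_surjective _ (map_zero _) fun k => ⟨algebraMap K _ k, (aug K).commutes k⟩

theorem augMap_map_eq_linearCombination {ι ι' : Type*} (φ : (ι →₀ Alg K) →ₗ[Alg K] (ι' →₀ Alg K))
    (p : ι →₀ Alg K) :
    augMap K ι' (φ p) =
      Finsupp.linearCombination K (fun i => augMap K ι' (φ (.single i 1))) (augMap K ι p) := by
  induction p using Finsupp.induction_linear with
  | zero => simp only [map_zero]
  | add p q hp hq => simp only [map_add, hp, hq]
  | single i r =>
    have hone : augMap K ι (.single i 1) = .single i 1 :=
      (Finsupp.mapRange_single (hf := map_zero _)).trans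
        (congrArg (Finsupp.single i) (map_one (aug K)))
    rw [← mul_one r, ← smul_eq_mul, ← Finsupp.smul_single, map_smul, augMap_smul, augMap_smul,
      map_smul, hone, Finsupp.linearCombination_single, one_smul]

theorem augMap_map_finsupp_S {κ ι : Type*} (φ : (κ →₀ S K) →ₗ[Alg K] (ι →₀ Alg K))
    (q : κ →₀ S K) : augMap K ι (φ q) = 0 := by
  induction q using Finsupp.induction_linear with
  | zero => simp only [map_zero]
  | add p q hp hq => simp only [map_add, hp, hq, add_zero]
  | single k s =>
    have hs : (s : Alg K) • (⟨e K, e_mem_S⟩ : S K) = s := Subtype.ext (mem_S_iff.1 s.2)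
    rw [← hs, ← Finsupp.smul_single, map_smul, augMap_smul, aug_eq_zero_of_mem_S s.2, zero_smul]

theorem mk_le_mk_of_surjective {ι ι' : Type v} {κ : Type*}
    {φ : (ι →₀ Alg K) × (κ →₀ S K) →ₗ[Alg K] (ι' →₀ Alg K)} (hφ : Function.Surjective φ) :
    #ι' ≤ #ι := by
  let f := Finsupp.linearCombination K fun i => augMap K ι' (φ (.single i 1, 0))
  have hf : Function.Surjective f := fun v => by
    obtain ⟨p, rfl⟩ := augMap_surjective ι' v
    obtain ⟨⟨p, q⟩, rfl⟩ := hφ p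
    refine ⟨augMap K ι p, ?_⟩
    have hsplit : φ (p, q) = φ (p, 0) + φ (0, q) := by
      rw [← map_add, Prod.mk_add_mk, add_zero, zero_add]
    have hq : augMap K ι' (φ (0, q)) = 0 := augMap_map_finsupp_S (φ ∘ₗ .inr _ _ _) q
    rw [hsplit, map_add, hq, add_zero]
    exact (augMap_map_eq_linearCombination (φ ∘ₗ .inl _ _ _) p).symm
  simpa only [rank_finsupp_self, lift_le] using f.rank_le_of_surjective hf

theorem mk_eq_mk_of_equiv {ι κ ι' κ' : Type v}
    (φ : ((ι →₀ Alg K) × (κ →₀ S K)) ≃ₗ[Alg K] (ι' →₀ Alg K) × (κ' →₀ S K)) : #ι = #ι' :=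
  le_antisymm
    (mk_le_mk_of_surjective (φ := .fst _ _ _ ∘ₗ φ.symm.toLinearMap)
      (Prod.fst_surjective.comp φ.symm.surjective))
    (mk_le_mk_of_surjective (φ := .fst _ _ _ ∘ₗ φ.toLinearMap)
      (Prod.fst_surjective.comp φ.surjective))

end Augmentation

section KernelOfX

variable {K : Type*} [Field K]

variable (K) in
/-- The `K`-space of elements of `M` killed by `x`. -/
noncomputable def xKer (M : Type*) [AddCommMonoid M] [Module K M] [Module (Alg K) M]
    [IsScalarTower K (Alg K) M] : Submodule K M :=
  LinearMap.ker (Algebra.lsmul K K M (x K))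

theorem rank_xKer_le_of_injective {M M' : Type u} [AddCommMonoid M] [Module K M]
    [Module (Alg K) M] [IsScalarTower K (Alg K) M] [AddCommMonoid M'] [Module K M']
    [Module (Alg K) M'] [IsScalarTower K (Alg K) M'] {φ : M →ₗ[Alg K] M'}
    (hφ : Function.Injective φ) :
    Module.rank K (xKer K M) ≤ Module.rank K (xKer K M') := by
  have hmaps : ∀ m ∈ xKer K M, φ.restrictScalars K m ∈ xKer K M' := fun m hm =>
    (map_smul φ (x K) m).symm.trans ((congrArg φ hm).trans (map_zero φ))
  exact LinearMap.rank_le_of_injective ((φ.restrictScalars K).restrict hmaps) fun m n h =>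
    Subtype.ext (hφ (congrArg Subtype.val h))

variable (K) in
/-- The `K`-linear map `g ↦ e * g(x)`, which parametrizes the kernel of `x` on `Alg K`. -/
noncomputable def eMulAeval : K[X] →ₗ[K] Alg K :=
  LinearMap.mulLeft K (e K) ∘ₗ (aeval (x K)).toLinearMap

theorem eMulAeval_injective : Function.Injective (eMulAeval K) :=
  (injective_iff_map_eq_zero _).2 fun _ => eq_zero_of_e_mul_aeval_eq_zero

theorem range_eMulAeval : LinearMap.range (eMulAeval K) = xKer K (Alg K) := by
  ext r
  refine ⟨?_, exists_e_mul_aeval_eq_of_x_mul_eq_zero⟩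
  rintro ⟨g, rfl⟩
  change x K * (e K * aeval (x K) g) = 0
  rw [← mul_assoc, x_mul_e, zero_mul]

variable (K) in
/-- The `K`-linear map `c ↦ c • e`, which parametrizes the kernel of `x` on `S K`. -/
noncomputable def smulE : K →ₗ[K] S K := LinearMap.toSpanSingleton K (S K) ⟨e K, e_mem_S⟩

theorem smulE_injective : Function.Injective (smulE K) := by
  refine (injective_iff_map_eq_zero _).2 fun c hc => ?_
  have hce : c • e K = 0 := congrArg Subtype.val hc
  exact (smul_eq_zero.1 hce).resolve_right e_ne_zero

theorem range_smulE : LinearMap.range (smulE K) = xKer K (S K) := by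
  ext s
  refine ⟨?_, fun hs => (exists_smul_e_eq_of_x_mul_eq_zero s.2 (congrArg Subtype.val hs)).imp
    fun _ => Subtype.ext⟩
  rintro ⟨c, rfl⟩
  refine Subtype.ext ?_
  change x K * c • e K = 0
  rw [mul_smul_comm, x_mul_e, smul_zero]

theorem rank_xKer {K : Type u} [Field K] (ι κ : Type v) :
    Module.rank K (xKer K ((ι →₀ Alg K) × (κ →₀ S K))) = Cardinal.lift.{u} (#ι * ℵ₀ + #κ) := by
  let u : (ι →₀ K[X]) × (κ →₀ K) →ₗ[K] (ι →₀ Alg K) × (κ →₀ S K) :=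
    (Finsupp.mapRange.linearMap (eMulAeval K)).prodMap (Finsupp.mapRange.linearMap (smulE K))
  have hrange : LinearMap.range u = xKer K ((ι →₀ Alg K) × (κ →₀ S K)) := by
    have hR := LinearMap.ker_eq_bot_of_injective (eMulAeval_injective (K := K))
    have hS := LinearMap.ker_eq_bot_of_injective (smulE_injective (K := K))
    rw [LinearMap.range_prodMap, Finsupp.range_mapRange_linearMap _ hR,
      Finsupp.range_mapRange_linearMap _ hS, range_eMulAeval, range_smulE]
    ext z
    simp [xKer, Prod.ext_iff, Finsupp.ext_iff]
  have hu : Function.Injective u := fun z w h => Prod.ext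
    (Finsupp.ext fun i => eMulAeval_injective (DFunLike.congr_fun (congrArg Prod.fst h) i))
    (Finsupp.ext fun k => smulE_injective (DFunLike.congr_fun (congrArg Prod.snd h) k))
  have hpoly : Module.rank K K[X] = ℵ₀ := by
    simpa using (basisMonomials K).mk_eq_rank.symm
  rw [← hrange, rank_range_of_injective u hu]
  simp [hpoly]

theorem mk_mul_aleph0_add_mk_eq_of_equiv {ι κ ι' κ' : Type v}
    (φ : ((ι →₀ Alg K) × (κ →₀ S K)) ≃ₗ[Alg K] (ι' →₀ Alg K) × (κ' →₀ S K)) :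
    #ι * ℵ₀ + #κ = #ι' * ℵ₀ + #κ' := by
  have h := le_antisymm (rank_xKer_le_of_injective φ.injective)
    (rank_xKer_le_of_injective φ.symm.injective)
  rw [rank_xKer, rank_xKer] at h
  exact lift_injective h

end KernelOfX

section Uniqueness

variable {K : Type*} [Field K]

theorem finite_of_finsupp_surjective {ι κ : Type*} [Finite ι]
    {φ : (ι →₀ Alg K) →ₗ[Alg K] (κ →₀ S K)} (hφ : Function.Surjective φ) : Finite κ := by
  have : Module.Finite (Alg K) (κ →₀ S K) := .of_surjective φ hφ
  rcases Module.finite_finsupp_iff.1 this with h | h | ⟨-, h⟩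
  · infer_instance
  · exact absurd h (not_subsingleton (S K))
  · exact h

theorem lt_aleph0_of_equiv_zero {α β : Cardinal.{v}} (hα : α < ℵ₀)
    (φ : DirectSumRS K α 0 ≃ₗ[Alg K] DirectSumRS K α β) : β < ℵ₀ := by
  have : Finite α.out := lt_aleph0_iff_finite.1 (by rwa [mk_out])
  have : IsEmpty (Quotient.out (0 : Cardinal.{v})) := mk_eq_zero_iff.1 (mk_out 0)
  have hκ : Finite β.out := finite_of_finsupp_surjective
    (φ := .snd _ _ _ ∘ₗ φ.toLinearMap ∘ₗ .inl _ _ _) fun q => by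
      obtain ⟨⟨p, z⟩, hpz⟩ := φ.surjective (0, q)
      obtain rfl : z = 0 := Subsingleton.elim z 0
      exact ⟨p, congrArg Prod.snd hpz⟩
  exact mk_out β ▸ lt_aleph0_iff_finite.2 hκ

theorem IsNormalized.eq_zero_or_aleph0_le_and_lt {α β : Cardinal.{v}} (h : IsNormalized α β)
    (hα : α ≠ 0) : β = 0 ∨ ℵ₀ ≤ β ∧ α < β := by
  rcases h with ⟨h, rfl | hβ⟩ | ⟨h, rfl | hβ⟩ | ⟨h, -⟩
  exacts [.inl rfl, .inr ⟨hβ, h.trans_le hβ⟩, .inl rfl, .inr ⟨h.trans hβ.le, hβ⟩, absurd h hα]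

theorem mul_aleph0_add_eq {α β : Cardinal.{v}} (hβ : ℵ₀ ≤ β) (h : α ≤ β) : α * ℵ₀ + β = β :=
  add_eq_right hβ (mul_le_of_le hβ h hβ)

theorem isEmpty_equiv_zero {α β : Cardinal.{v}} (hβ : ℵ₀ ≤ β) (h : α < β) :
    IsEmpty (DirectSumRS K α 0 ≃ₗ[Alg K] DirectSumRS K α β) := by
  refine ⟨fun φ => ?_⟩
  rcases lt_or_ge α ℵ₀ with hα | hα
  · exact (lt_aleph0_of_equiv_zero hα φ).not_ge hβ
  · have hcard : α * ℵ₀ + 0 = α * ℵ₀ + β := by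
      simpa only [mk_out] using mk_mul_aleph0_add_mk_eq_of_equiv φ
    rw [mul_aleph0_add_eq hβ h.le, add_zero, mul_aleph0_eq hα] at hcard
    exact h.ne hcard

theorem IsNormalized.eq_of_equiv {α β α' β' : Cardinal.{v}} (h : IsNormalized α β)
    (h' : IsNormalized α' β') (φ : DirectSumRS K α β ≃ₗ[Alg K] DirectSumRS K α' β') :
    α = α' ∧ β = β' := by
  obtain rfl : α = α' := by simpa only [mk_out] using mk_eq_mk_of_equiv φ
  refine ⟨rfl, ?_⟩
  have hcard : α * ℵ₀ + β = α * ℵ₀ + β' := by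
    simpa only [mk_out] using mk_mul_aleph0_add_mk_eq_of_equiv φ
  rcases eq_or_ne α 0 with rfl | hα
  · simpa only [zero_mul, zero_add] using hcard
  rcases h.eq_zero_or_aleph0_le_and_lt hα with rfl | ⟨hβ, hαβ⟩ <;>
    rcases h'.eq_zero_or_aleph0_le_and_lt hα with rfl | ⟨hβ', hαβ'⟩
  · rfl
  · exact (isEmpty_equiv_zero (K := K) hβ' hαβ').elim φ
  · exact (isEmpty_equiv_zero (K := K) hβ hαβ).elim φ.symm
  · rwa [mul_aleph0_add_eq hβ hαβ.le, mul_aleph0_add_eq hβ' hαβ'.le] at hcard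

end Uniqueness

end ToeplitzJacobson

theorem corollary2 (K : Type u) [Field K] :
    -- every projective left module is isomorphic to some `R^(α) ⊕ S^(β)`
    (∀ (P : Type v) [AddCommGroup P] [Module (ToeplitzJacobson.Alg K) P]
        [Module.Projective (ToeplitzJacobson.Alg K) P],
      ∃ α β : Cardinal.{v},
        Nonempty (P ≃ₗ[ToeplitzJacobson.Alg K] ToeplitzJacobson.DirectSumRS K α β)) ∧
    -- the pair can be chosen normalized, and the normalized pair is unique
    (∀ (P : Type v) [AddCommGroup P] [Module (ToeplitzJacobson.Alg K) P]
        [Module.Projective (ToeplitzJacobson.Alg K) P],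
      ∃! p : Cardinal.{v} × Cardinal.{v},
        ToeplitzJacobson.IsNormalized p.1 p.2 ∧
        Nonempty (P ≃ₗ[ToeplitzJacobson.Alg K] ToeplitzJacobson.DirectSumRS K p.1 p.2)) ∧
    -- every `R^(α) ⊕ S^(β)` is projective
    (∀ α β : Cardinal.{v},
      Module.Projective (ToeplitzJacobson.Alg K) (ToeplitzJacobson.DirectSumRS K α β)) ∧
    -- distinct normalized pairs give non-isomorphic modules
    (∀ α β α' β' : Cardinal.{v},
      ToeplitzJacobson.IsNormalized α β → ToeplitzJacobson.IsNormalized α' β' →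
      Nonempty (ToeplitzJacobson.DirectSumRS K α β ≃ₗ[ToeplitzJacobson.Alg K]
        ToeplitzJacobson.DirectSumRS K α' β') →
      α = α' ∧ β = β') := by
  refine ⟨fun P _ _ _ => ?_, fun P _ _ _ => ?_, ToeplitzJacobson.projective_directSumRS,
    fun α β α' β' h h' ⟨φ⟩ => h.eq_of_equiv h' φ⟩
  · obtain ⟨α, β, -, hP⟩ := ToeplitzJacobson.exists_isNormalized_equiv_directSumRS (K := K) P
    exact ⟨α, β, hP⟩
  · obtain ⟨α, β, h, ⟨φ⟩⟩ := ToeplitzJacobson.exists_isNormalized_equiv_directSumRS (K := K) P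
    refine ⟨(α, β), ⟨h, ⟨φ⟩⟩, ?_⟩
    rintro ⟨α', β'⟩ ⟨h', ⟨φ'⟩⟩
    obtain ⟨rfl, rfl⟩ := h'.eq_of_equiv h (φ'.symm ≪≫ₗ φ)
    rfl
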